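/- Let $\mathrm{L}=\mathcal R\cup\mathcal D$ be a signature consisting of finitary relation symbols $\mathcal R$ and constant symbols $\mathcal D$, let $\kappa$ be an infinite cardinal, and let $\mathcal C$ be an infinite set of new constant symbols of size at most $\kappa$. $\mathrm{L}(\mathcal C)_{\kappa\omega}$-formulas are built from atomic formulas (including equalities) by negation, by conjunctions and disjunctions of sets of fewer than $\kappa$ formulas whose free variables lie in one finite set, and by universal and existential quantification over finite sets of variables. For a formula $\phi$, let $\phi\neg$ be $\neg\phi$ if $\phi$ is atomic, and let $(\neg\phi)\neg=\phi$, $(\bigwedge\Phi)\neg=\bigvee_{\phi\in\Phi}\neg\phi$, $(\bigvee\Phi)\neg=\bigwedge_{\phi\in\Phi}\neg\phi$, $(\forall\vec v\,\phi)\neg=\exists\vec v\,\neg\phi$, $(\exists\vec v\,\phi)\neg=\forall\vec v\,\neg\phi$. Let $S$ be a consistency property consisting of finite sets of $\mathrm{L}(\mathcal C)_{\kappa\omega}$-sentences, i.e. for every $s\in S$: (Con) no $\phi$ has both $\phi\in s$ and $\neg\phi\in s$; (Ind.1) if $\neg\phi\in s$ then $s\cup\{\phi\neg\}\in S$; (Ind.2)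 if $\bigwedge\Phi\in s$ then $s\cup\{\phi\}\in S$ for all $\phi\in\Phi$; (Ind.3) if $\forall\vec v\,\phi(\vec v)\in s$ then $s\cup\{\phi(\vec c)\}\in S$ for all $\vec c$ from $\mathcal C\cup\mathcal D$; (Ind.4) if $\bigvee\Phi\in s$ then $s\cup\{\phi\}\in S$ for some $\phi\in\Phi$; (Ind.5) if $\exists\vec v\,\phi(\vec v)\in s$ then $s\cup\{\phi(\vec c)\}\in S$ for some $\vec c$ from $\mathcal C$; (Str.1) if $c,d\in\mathcal C\cup\mathcal D$ and $c=d\in s$ then $s\cup\{d=c\}\in S$; (Str.2) if $c,d\in\mathcal C\cup\mathcal D$ and $\{c=d,\phi(d)\}\subseteq s$ then $s\cup\{\phi(c)\}\in S$; (Str.3) for every $d\in\mathcal C\cup\mathcal D$ there is $c\in\mathcal C$ with $s\cup\{c=d\}\in S$. Let $\mathbb P_S$ be the set of all subsets of elements of $S$, ordered by reverse inclusion, let $\mathsf B=\mathrm{RO}(\mathbb P_S)$ be the complete Boolean algebra of regular open sets of the topology on $\mathbb P_S$ whose open sets are the downward closed sets, and let $V^{\mathsf B}$ be the Boolean valued universe.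 Let $\dot G$ be the canonical name for the generic filter and $\Sigma_{\dot G}=\bigcup\dot G$. The name $\mathcal A_{\dot G}$ denotes the generic term model: its domain $A_{\dot G}$ consists of the classes $[c]_{\dot G}=\{d\in\mathcal C\cup\mathcal D:(c=d)\in\Sigma_{\dot G}\}$ for $c\in\mathcal C\cup\mathcal D$; $R_{\dot G}(\sigma_1,\dots,\sigma_n)$ holds if and only if there are constants $c_i$ with $\sigma_i=[c_i]_{\dot G}$ and $R(c_1,\dots,c_n)\in\Sigma_{\dot G}$; each $d\in\mathcal C\cup\mathcal D$ is interpreted as $[d]_{\dot G}$. The value $[\![\mathcal A_{\dot G}\models\phi(\vec\sigma)]\!]^{V^{\mathsf B}}$ is the value in $V^{\mathsf B}$ of the $\mathrm L_{\infty\omega}$-assertion about $\in$ obtained by relativizing the quantifiers of $\phi$ to $A_{\dot G}$. There are regular cardinals $\mu$ such that every name $\sigma$ with $[\![\sigma\in A_{\dot G}]\!]=1$ is equal, with Boolean value $1$, to a name in $V^{\mathsf B}\cap H_\mu$. For any such $\mu$, let $\mathcal A_S$ be the structure with domain $\{\sigma\in V^{\mathsf B}\cap H_\mu:[\![\sigma\in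 A_{\dot G}]\!]=1_{\mathsf B}\}$, with $[\![\sigma=\tau]\!]^{\mathcal A_S}=[\![\sigma=\tau]\!]^{V^{\mathsf B}}$ and $[\![R(\vec\sigma)]\!]^{\mathcal A_S}=[\![\mathcal A_{\dot G}\models R_{\dot G}(\vec\sigma)]\!]^{V^{\mathsf B}}$ for $R\in\mathcal R$, and with each $d\in\mathcal C\cup\mathcal D$ interpreted by a name in the domain which equals $[d]_{\dot G}$ with value $1$. Then: 1. $\mathcal A_S$ is a $\mathsf B$-valued model for $\mathrm L(\mathcal C)$ with the mixing property: for every antichain $A\subseteq\mathsf B$ and every family $(\tau_a)_{a\in A}$ of its elements there is an element $\tau$ with $a\le[\![\tau=\tau_a]\!]$ for all $a\in A$. Moreover, for every $s\in S$, $$\Big[\!\!\Big[\bigwedge s\Big]\!\!\Big]^{\mathcal A_S}_{\mathsf B}=\Big[\!\!\Big[\mathcal A_{\dot G}\models\bigwedge s\Big]\!\!\Big]^{V^{\mathsf B}}_{\mathsf B}.$$ 2. Consequently, for every $s\in S$ there are a complete Boolean algebra $\mathsf B'$ with $0\ne1$ and a $\mathsf B'$-valued model $\mathcal M$ for $\mathrm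 L(\mathcal C)$ with the mixing property such that $[\![\bigwedge s]\!]^{\mathcal M}_{\mathsf B'}=1_{\mathsf B'}$. -/

import Mathlib

open Cardinal

universe u

noncomputable section

namespace BVLogic

/-! ## Formulas -/

/-- A relational `ω`-signature: finitary relation symbols and constant symbols. -/
structure RelSignature where
  Rel : ℕ → Type u
  Const : Type u

/-- The signature `L(C)`: add to `L` the elements of `C` as new constant symbols. -/
abbrev RelSignature.withConsts (L : RelSignature.{u}) (C : Type u) : RelSignature.{u} :=
  ⟨L.Rel, L.Const ⊕ C⟩

/-- Terms: variables, taken from a set of size `κ`, and constants. -/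
inductive Tm (L : RelSignature.{u}) (κ : Cardinal.{u}) : Type u
  | var (x : κ.out) : Tm L κ
  | const (c : L.Const) : Tm L κ

/-- Raw infinitary formulas. A set of formulas of size `< κ` is presented as a family indexed by a
subset `I` of a fixed set of size `κ`; quantifiers bind a finite set `V` of variables. The size and
free-variable restrictions are imposed in `PreFormula.IsFormula`. -/
inductive PreFormula (L : RelSignature.{u}) (κ : Cardinal.{u}) : Type u
  | eq (t₁ t₂ : Tm L κ) : PreFormula L κ
  | rel {n : ℕ} (R : L.Rel n) (t : Fin n → Tm L κ) : PreFormula L κ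
  | neg (φ : PreFormula L κ) : PreFormula L κ
  | conj (I : Set κ.out) (φ : I → PreFormula L κ) : PreFormula L κ
  | disj (I : Set κ.out) (φ : I → PreFormula L κ) : PreFormula L κ
  | all (V : Finset κ.out) (φ : PreFormula L κ) : PreFormula L κ
  | ex (V : Finset κ.out) (φ : PreFormula L κ) : PreFormula L κ

section Formulas

variable {L : RelSignature.{u}} {κ : Cardinal.{u}}

def Tm.freeVars : Tm L κ → Set κ.out
  | .var x => {x}
  | .const _ => ∅

def PreFormula.freeVars : PreFormula L κ → Set κ.out
  | .eq t₁ t₂ => t₁.freeVars ∪ t₂.freeVars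
  | .rel _ t => ⋃ i, (t i).freeVars
  | .neg φ => φ.freeVars
  | .conj _ φ => ⋃ i, (φ i).freeVars
  | .disj _ φ => ⋃ i, (φ i).freeVars
  | .all V φ => φ.freeVars \ V
  | .ex V φ => φ.freeVars \ V

/-- `L_{κω}`-formulas: conjunctions and disjunctions are over sets of fewer than `κ` formulas whose
free variables all lie in one finite set. -/
def PreFormula.IsFormula : PreFormula L κ → Prop
  | .eq _ _ => True
  | .rel _ _ => True
  | .neg φ => φ.IsFormula
  | .conj I φ => #I < κ ∧ (⋃ i, (φ i).freeVars).Finite ∧ ∀ i, (φ i).IsFormula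
  | .disj I φ => #I < κ ∧ (⋃ i, (φ i).freeVars).Finite ∧ ∀ i, (φ i).IsFormula
  | .all _ φ => φ.IsFormula
  | .ex _ φ => φ.IsFormula

/-- `L_{κω}`-sentences. -/
def PreFormula.IsSentence (φ : PreFormula L κ) : Prop :=
  φ.IsFormula ∧ φ.freeVars = ∅

/-- Moving a negation inside: the formula `φ¬`. -/
def PreFormula.negIn : PreFormula L κ → PreFormula L κ
  | .eq t₁ t₂ => .neg (.eq t₁ t₂)
  | .rel R t => .neg (.rel R t)
  | .neg φ => φ
  | .conj I φ => .disj I (fun i => .neg (φ i))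
  | .disj I φ => .conj I (fun i => .neg (φ i))
  | .all V φ => .ex V (.neg φ)
  | .ex V φ => .all V (.neg φ)

/-- Substitute constants for the variables on which `ρ` is defined. -/
def Tm.subst (ρ : κ.out → Option L.Const) : Tm L κ → Tm L κ
  | .var x => (ρ x).elim (.var x) .const
  | .const c => .const c

open Classical in
/-- Substitute constants for the free occurrences of the variables on which `ρ` is defined. -/
def PreFormula.subst : (κ.out → Option L.Const) → PreFormula L κ → PreFormula L κ
  | ρ, .eq t₁ t₂ => .eq (t₁.subst ρ) (t₂.subst ρ)
  | ρ, .rel R t => .rel R (fun i => (t i).subst ρ)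
  | ρ, .neg φ => .neg (φ.subst ρ)
  | ρ, .conj I φ => .conj I (fun i => (φ i).subst ρ)
  | ρ, .disj I φ => .disj I (fun i => (φ i).subst ρ)
  | ρ, .all V φ => .all V (φ.subst (fun x => if x ∈ V then none else ρ x))
  | ρ, .ex V φ => .ex V (φ.subst (fun x => if x ∈ V then none else ρ x))

open Classical in
/-- `φ(c)`: the string of constants `c` replaces the free occurrences of the variables in `V`. -/
def PreFormula.inst (φ : PreFormula L κ) (V : Finset κ.out) (c : V → L.Const) : PreFormula L κ :=
  φ.subst (fun x => if h : x ∈ V then some (c ⟨x, h⟩) else none)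

/-- `φ(d)`: the constant `d` replaces the free occurrences of the variable `x`. -/
def PreFormula.inst₁ (φ : PreFormula L κ) (x : κ.out) (d : L.Const) : PreFormula L κ :=
  φ.inst {x} (fun _ => d)

theorem exists_embedding (hκ : ℵ₀ ≤ κ) (s : Set (PreFormula L κ)) (hs : s.Finite) :
    Nonempty (s ↪ κ.out) := by
  have h : #s ≤ #κ.out := by
    rw [Cardinal.mk_out]
    exact (Cardinal.lt_aleph0_iff_set_finite.2 hs).le.trans hκ
  exact h

/-- The formula `⋀ s` for a finite set `s` of formulas. -/
def bigAnd (hκ : ℵ₀ ≤ κ) (s : Set (PreFormula L κ)) (hs : s.Finite) : PreFormula L κ :=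
  let e := (exists_embedding hκ s hs).some
  .conj (Set.range e) (fun i => ((Equiv.ofInjective e e.injective).symm i : s))

end Formulas

/-! ## Consistency properties -/

/-- Consistency properties for `L(C)_{κω}`. -/
structure IsConsistencyProperty (L : RelSignature.{u}) (C : Type u) (κ : Cardinal.{u})
    (S : Set (Set (PreFormula (L.withConsts C) κ))) : Prop where
  sentences : ∀ s ∈ S, ∀ φ ∈ s, φ.IsSentence
  con : ∀ s ∈ S, ∀ φ, φ ∉ s ∨ .neg φ ∉ s
  ind1 : ∀ s ∈ S, ∀ φ, .neg φ ∈ s → s ∪ {φ.negIn} ∈ S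
  ind2 : ∀ s ∈ S, ∀ I φ, .conj I φ ∈ s → ∀ i, s ∪ {φ i} ∈ S
  ind3 : ∀ s ∈ S, ∀ (V : Finset κ.out) φ, .all V φ ∈ s → ∀ c : V → L.Const ⊕ C, s ∪ {φ.inst V c} ∈ S
  ind4 : ∀ s ∈ S, ∀ I φ, .disj I φ ∈ s → ∃ i, s ∪ {φ i} ∈ S
  ind5 : ∀ s ∈ S, ∀ (V : Finset κ.out) φ, .ex V φ ∈ s →
    ∃ c : V → C, s ∪ {φ.inst V (fun x => Sum.inr (c x))} ∈ S
  str1 : ∀ s ∈ S, ∀ c d : L.Const ⊕ C,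
    .eq (.const c) (.const d) ∈ s → s ∪ {.eq (.const d) (.const c)} ∈ S
  str2 : ∀ s ∈ S, ∀ (c d : L.Const ⊕ C) (φ : PreFormula (L.withConsts C) κ) (x : κ.out),
    .eq (.const c) (.const d) ∈ s → φ.inst₁ x d ∈ s → s ∪ {φ.inst₁ x c} ∈ S
  str3 : ∀ s ∈ S, ∀ d : L.Const ⊕ C,
    ∃ c : C, s ∪ {.eq (.const (Sum.inr c)) (.const d)} ∈ S

/-! ## Boolean valued models -/

/-- The data of a `B`-valued model for `L`. -/
structure BValStructure (L : RelSignature.{u}) (B : Type u) where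
  carrier : Type u
  eqv : carrier → carrier → B
  relv : ∀ {n : ℕ}, L.Rel n → (Fin n → carrier) → B
  const : L.Const → carrier

namespace BValStructure

variable {L : RelSignature.{u}} {κ : Cardinal.{u}} {B : Type u} [CompleteBooleanAlgebra B]

/-- The axioms of `B`-valued models. -/
structure IsModel (M : BValStructure L B) : Prop where
  nonempty : Nonempty M.carrier
  refl : ∀ a, M.eqv a a = ⊤
  symm : ∀ a b, M.eqv a b = M.eqv b a
  trans : ∀ a b c, M.eqv a b ⊓ M.eqv b c ≤ M.eqv a c
  subst : ∀ {n : ℕ} (R : L.Rel n) (a b : Fin n → M.carrier),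
    (⨅ i, M.eqv (a i) (b i)) ⊓ M.relv R a ≤ M.relv R b

/-- The mixing property. -/
def Mixing (M : BValStructure L B) : Prop :=
  ∀ A : Set B, (∀ a ∈ A, ∀ b ∈ A, a ≠ b → a ⊓ b = ⊥) →
    ∀ τ : A → M.carrier, ∃ t : M.carrier, ∀ a : A, (a : B) ≤ M.eqv t (τ a)

def evalTm (M : BValStructure L B) (v : κ.out → M.carrier) : Tm L κ → M.carrier
  | .var x => v x
  | .const c => M.const c

open Classical in
/-- The Boolean value of a formula under an assignment of the variables. -/
def val (M : BValStructure L B) : (κ.out → M.carrier) → PreFormula L κ → B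
  | v, .eq t₁ t₂ => M.eqv (M.evalTm v t₁) (M.evalTm v t₂)
  | v, .rel R t => M.relv R (fun i => M.evalTm v (t i))
  | v, .neg φ => (M.val v φ)ᶜ
  | v, .conj _ φ => ⨅ i, M.val v (φ i)
  | v, .disj _ φ => ⨆ i, M.val v (φ i)
  | v, .all V φ =>
      ⨅ a : V → M.carrier, M.val (fun x => if h : x ∈ V then a ⟨x, h⟩ else v x) φ
  | v, .ex V φ =>
      ⨆ a : V → M.carrier, M.val (fun x => if h : x ∈ V then a ⟨x, h⟩ else v x) φ

end BValStructure

/-! ## Regular open algebras -/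

/-- The regular open algebra of a preorder `P`: regular elements of the lattice of downward closed
sets, i.e. of the open sets of the order topology (`Uᶜᶜ` is the interior of the closure of `U`). -/
def RO (P : Type u) [Preorder P] : Type u := Heyting.Regular (LowerSet P)

namespace RO

variable {P : Type u} [Preorder P]

instance : CompleteBooleanAlgebra (RO P) :=
  { (inferInstanceAs (BooleanAlgebra (Heyting.Regular (LowerSet P))) : BooleanAlgebra (RO P)) with
    sSup := (Heyting.Regular.gi (α := LowerSet P)).liftCompleteLattice.sSup
    isLUB_sSup := (Heyting.Regular.gi (α := LowerSet P)).liftCompleteLattice.isLUB_sSup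
    sInf := (Heyting.Regular.gi (α := LowerSet P)).liftCompleteLattice.sInf
    isGLB_sInf := (Heyting.Regular.gi (α := LowerSet P)).liftCompleteLattice.isGLB_sInf }

/-- `Reg(N_p)`, the regularization of the cone `N_p` of all `q ≤ p`. -/
def reg (p : P) : RO P := Heyting.Regular.toRegular (LowerSet.Iic p)

end RO

/-! ## The forcing notion of a consistency property -/

section Forcing

variable {L : RelSignature.{u}} {κ : Cardinal.{u}}

/-- `P_S`: all subsets of elements of `S`, ordered by reverse inclusion. -/
def Cond (S : Set (Set (PreFormula L κ))) : Type u :=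
  {p : Set (PreFormula L κ) // ∃ s ∈ S, p ⊆ s}

instance (S : Set (Set (PreFormula L κ))) : PartialOrder (Cond S) where
  le p q := q.1 ⊆ p.1
  le_refl _ := subset_rfl
  le_trans _ _ _ h₁ h₂ := h₂.trans h₁
  le_antisymm _ _ h₁ h₂ := Subtype.ext (h₂.antisymm h₁)

/-- The Boolean value of `φ ∈ Σ_G`, where `Σ_G` is the union of the generic filter `G`. -/
def sigmaVal (S : Set (Set (PreFormula L κ))) (φ : PreFormula L κ) : RO (Cond S) :=
  ⨆ p : {p : Cond S // φ ∈ p.1}, RO.reg p.1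

end Forcing

/-! ## The Boolean valued universe -/

/-- `B`-names, the elements of `V^B`: a name is a set of pairs `(A i, b i)` with `A i` a name and
`b i` in `B`. -/
inductive BName (B : Type u) : Type (u + 1)
  | mk (ι : Type u) (A : ι → BName B) (b : ι → B) : BName B

namespace BName

variable {B : Type u} [CompleteBooleanAlgebra B]

/-- The Boolean value of `x = y` in `V^B`. -/
def eqVal : BName B → BName B → B
  | .mk _ A b, .mk _ A' b' =>
      (⨅ i, b i ⇨ ⨆ j, b' j ⊓ eqVal (A i) (A' j)) ⊓ (⨅ j, b' j ⇨ ⨆ i, b i ⊓ eqVal (A i) (A' j))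

/-- The Boolean value of `x ∈ y` in `V^B`. -/
def memVal (x : BName B) : BName B → B
  | .mk _ A b => ⨆ j, b j ⊓ eqVal x (A j)

/-- The canonical name of a (pre-)set. -/
def checkP : PSet.{u} → BName B
  | .mk ι A => .mk ι (fun i => checkP (A i)) (fun _ => ⊤)

/-- The canonical name of a set. -/
def check (x : ZFSet.{u}) : BName B := checkP (Quotient.out x)

end BName

/-- `V^B ∩ H_μ`: the names that hereditarily have fewer than `μ` elements; a set of fewer than `μ`
pairs is presented as a family indexed by a subset of a fixed set of size `μ`. -/
inductive HName (B : Type u) (μ : Cardinal.{u}) : Type u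
  | mk (I : Set μ.out) (hI : #I < μ) (A : I → HName B μ) (b : I → B) : HName B μ

/-- A name in `V^B ∩ H_μ` as a name in `V^B`. -/
def HName.toBName {B : Type u} {μ : Cardinal.{u}} : HName B μ → BName B
  | .mk I _ A b => .mk I (fun i => (A i).toBName) b

/-! ## The generic term model and the structure `A_S` -/

section TermModel

variable {L : RelSignature.{u}} {κ : Cardinal.{u}} (S : Set (Set (PreFormula L κ)))
  (code : L.Const ↪ ZFSet.{u})

/-- The name of the class `[c]_G = {d : (c = d) ∈ Σ_G}` of the constant `c`. As elements of the
universe of sets, constants are identified with their images under the injection `code`. -/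
def className (c : L.Const) : BName (RO (Cond S)) :=
  .mk L.Const (fun d => BName.check (code d)) (fun d => sigmaVal S (.eq (.const c) (.const d)))

/-- The name of the domain `A_G = {[c]_G : c a constant}` of the generic term model. -/
def domName : BName (RO (Cond S)) :=
  .mk L.Const (className S code) (fun _ => ⊤)

/-- The interpretation of terms in the generic term model. -/
def evalName (v : κ.out → BName (RO (Cond S))) : Tm L κ → BName (RO (Cond S))
  | .var x => v x
  | .const c => className S code c

/-- The Boolean value of `R_G(σ₁, …, σₙ)`, that is of the assertion that there are constants
`c₁, …, cₙ` with `σᵢ = [cᵢ]_G` for all `i` and `R(c₁, …, cₙ) ∈ Σ_G`. -/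
def relVal {n : ℕ} (R : L.Rel n) (σ : Fin n → BName (RO (Cond S))) : RO (Cond S) :=
  ⨆ c : Fin n → L.Const,
    (⨅ i, BName.eqVal (σ i) (className S code (c i))) ⊓ sigmaVal S (.rel R (fun i => .const (c i)))

open Classical in
/-- The Boolean value, in `V^B`, of the assertion that the generic term model satisfies a formula
under an assignment of names to the variables. Quantifiers range over all names, and are
relativized to the domain `A_G`. -/
def satVal : (κ.out → BName (RO (Cond S))) → PreFormula L κ → RO (Cond S)
  | v, .eq t₁ t₂ => BName.eqVal (evalName S code v t₁) (evalName S code v t₂)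
  | v, .rel R t => relVal S code R (fun i => evalName S code v (t i))
  | v, .neg φ => (satVal v φ)ᶜ
  | v, .conj _ φ => ⨅ i, satVal v (φ i)
  | v, .disj _ φ => ⨆ i, satVal v (φ i)
  | v, .all V φ =>
      ⨅ a : V → BName (RO (Cond S)), (⨅ x, BName.memVal (a x) (domName S code)) ⇨
        satVal (fun x => if h : x ∈ V then a ⟨x, h⟩ else v x) φ
  | v, .ex V φ =>
      ⨆ a : V → BName (RO (Cond S)), (⨅ x, BName.memVal (a x) (domName S code)) ⊓
        satVal (fun x => if h : x ∈ V then a ⟨x, h⟩ else v x) φ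

/-- `μ` is big enough: every name which is with value `1` an element of `A_G` is with value `1`
equal to a name in `H_μ`. -/
def IsBigEnough (μ : Cardinal.{u}) : Prop :=
  ∀ σ : BName (RO (Cond S)), BName.memVal σ (domName S code) = ⊤ →
    ∃ τ : HName (RO (Cond S)) μ, BName.eqVal τ.toBName σ = ⊤

end TermModel

namespace BName

variable {B : Type u} [CompleteBooleanAlgebra B]

theorem eqVal_refl (x : BName B) : eqVal x x = ⊤ := by
  induction x with
  | mk ι A b ih =>
    rw [eqVal, eq_top_iff]
    refine le_inf (le_iInf fun i => ?_) (le_iInf fun i => ?_)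
    · rw [le_himp_iff, top_inf_eq]
      exact le_iSup_of_le i (by rw [ih i, inf_top_eq])
    · rw [le_himp_iff, top_inf_eq]
      exact le_iSup_of_le i (by rw [ih i, inf_top_eq])

end BName

section TermModel

variable {L : RelSignature.{u}} {κ : Cardinal.{u}} (S : Set (Set (PreFormula L κ)))
  (code : L.Const ↪ ZFSet.{u})

theorem memVal_of_eqVal_className (x : BName (RO (Cond S))) (c : L.Const)
    (h : BName.eqVal x (className S code c) = ⊤) : BName.memVal x (domName S code) = ⊤ := by
  rw [domName, BName.memVal, eq_top_iff]
  exact le_iSup_of_le c (by rw [h, inf_top_eq])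

/-- The structure `A_S`. Its elements are the names `σ` in `V^B ∩ H_μ` for which `σ ∈ A_G` has value
`1`; equality and relations are evaluated in `V^B`; and the constant `d` is interpreted by an
`H_μ`-name of its class `[d]_G`. -/
def termModel (μ : Cardinal.{u}) (hμ : IsBigEnough S code μ) : BValStructure L (RO (Cond S)) where
  carrier := {σ : HName (RO (Cond S)) μ // BName.memVal σ.toBName (domName S code) = ⊤}
  eqv σ τ := BName.eqVal σ.1.toBName τ.1.toBName
  relv R σ := relVal S code R (fun i => (σ i).1.toBName)
  const d :=
    have h := hμ (className S code d)
      (memVal_of_eqVal_className S code _ d (BName.eqVal_refl _))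
    ⟨h.choose, memVal_of_eqVal_className S code _ d h.choose_spec⟩

/-- An element of `A_S`, as a name in `V^B`. -/
def termModelName {μ : Cardinal.{u}} {hμ : IsBigEnough S code μ}
    (σ : (termModel S code μ hμ).carrier) : BName (RO (Cond S)) :=
  HName.toBName (Subtype.val σ)

end TermModel

end BVLogic

end

open BVLogic

namespace BVLogic

/-! ## Reasoning below an element of a frame -/

section Frame

variable {B : Type u} [CompleteBooleanAlgebra B] {a b Γ : B}

/-! Two independent facts carry the proof.

Agreement of values needs no consistency property and holds for every formula, not only for `⋀ s`.
By `memVal_domName`, a name belongs to `A_G` exactly to the extent that it equals the class of some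
constant. Hence the relativized quantifiers over all names collapse to quantifiers over constants
(`satVal_all`, `satVal_ex`). Every class of a constant has a representative in `A_S`, and every
element of `A_S` lies in `A_G` with value `⊤`, so `val_eq_satVal` follows by induction on the
formula. A suitable `μ` exists because a member of `A_G` is determined by which codes of constants
it contains. Mixing is inherited from `V^B`.

The truth lemma `sigmaVal_le_satVal` uses the consistency property: if `φ` is in the generic set of
formulas, then the generic term model satisfies `φ`. Each closure clause of `S` becomes, by density,
an inequality between values `sigmaVal`, and an induction on `φ` treats `φ` and its negation
together.

For a model giving `⋀ s` value `⊤`, one forces with the elements of `S` that extend `s`. Every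
formula of `s` then lies in the generic set with value `⊤`, and the truth lemma applies. -/

theorem le_of_le_iSup {ι : Sort*} {f : ι → B} (h : Γ ≤ ⨆ i, f i)
    (k : ∀ i, ∀ Δ ≤ Γ, Δ ≤ f i → Δ ≤ b) : Γ ≤ b := by
  rw [← inf_eq_left.2 h, inf_iSup_eq]
  exact iSup_le fun i => k i _ inf_le_left inf_le_right

/-- Elements of the algebra act as conditions: an implication is proved at `Γ` by passing to a
stronger `Δ` that decides the hypothesis. -/
theorem le_himp_of_forall (h : ∀ Δ ≤ Γ, Δ ≤ a → Δ ≤ b) : Γ ≤ a ⇨ b :=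
  le_himp_iff.2 (h _ inf_le_left inf_le_right)

theorem le_of_le_himp (h : Γ ≤ a ⇨ b) (ha : Γ ≤ a) : Γ ≤ b := by
  simpa [inf_eq_left.2 ha] using le_himp_iff.1 h

theorem le_compl_of_forall (h : ∀ Δ ≤ Γ, Δ ≤ a → Δ ≤ ⊥) : Γ ≤ aᶜ := by
  rw [← himp_bot]; exact le_himp_of_forall h

theorem le_bot_of_le_compl (h : Γ ≤ aᶜ) (ha : Γ ≤ a) : Γ ≤ ⊥ := by
  rw [← himp_bot] at h; exact le_of_le_himp h ha

end Frame

/-! ## Boolean valued set theory -/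

namespace BName

variable {B : Type u} [CompleteBooleanAlgebra B] {Γ : B}

theorem le_memVal_mk {ι : Type u} {A : ι → BName B} {b : ι → B} {x : BName B} (i : ι)
    (hb : Γ ≤ b i) (h : Γ ≤ eqVal x (A i)) : Γ ≤ memVal x (mk ι A b) := by
  rw [memVal]; exact le_iSup_of_le i (le_inf hb h)

theorem eqVal_mk {ι ι' : Type u} (A : ι → BName B) (b : ι → B) (A' : ι' → BName B) (b' : ι' → B) :
    eqVal (mk ι A b) (mk ι' A' b') =
      (⨅ i, b i ⇨ ⨆ j, b' j ⊓ eqVal (A i) (A' j)) ⊓ ⨅ j, b' j ⇨ ⨆ i, b i ⊓ eqVal (A i) (A' j) := by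
  rw [eqVal]

theorem eqVal_symm (x y : BName B) : eqVal x y = eqVal y x := by
  induction x generalizing y with
  | mk ι A b ih =>
    cases y with
    | mk ι' A' b' =>
      rw [eqVal_mk, eqVal_mk, inf_comm]
      simp only [ih]

theorem le_eqVal_mk {ι ι' : Type u} {A : ι → BName B} {b : ι → B} {A' : ι' → BName B} {b' : ι' → B}
    (h₁ : ∀ i, ∀ Δ ≤ Γ, Δ ≤ b i → Δ ≤ memVal (A i) (mk ι' A' b'))
    (h₂ : ∀ j, ∀ Δ ≤ Γ, Δ ≤ b' j → Δ ≤ memVal (A' j) (mk ι A b)) :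
    Γ ≤ eqVal (mk ι A b) (mk ι' A' b') := by
  rw [eqVal_mk]
  refine le_inf (le_iInf fun i => le_himp_of_forall fun Δ hΔ hb => ?_)
    (le_iInf fun j => le_himp_of_forall fun Δ hΔ hb => ?_)
  · simpa only [memVal] using h₁ i Δ hΔ hb
  · simpa only [memVal, eqVal_symm (A' j)] using h₂ j Δ hΔ hb

theorem le_memVal_of_le_eqVal_mk {ι : Type u} {A : ι → BName B} {b : ι → B} {y : BName B}
    (h : Γ ≤ eqVal (mk ι A b) y) (i : ι) (hb : Γ ≤ b i) : Γ ≤ memVal (A i) y := by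
  cases y with
  | mk ι' A' b' =>
    rw [eqVal_mk] at h
    rw [memVal]
    exact le_of_le_himp ((h.trans inf_le_left).trans (iInf_le _ i)) hb

theorem le_eqVal_trans {x y z : BName B} (h₁ : Γ ≤ eqVal x y) (h₂ : Γ ≤ eqVal y z) :
    Γ ≤ eqVal x z := by
  induction x generalizing y z Γ with
  | mk ι A b ih =>
    cases y with
    | mk ι' A' b' =>
      cases z with
      | mk ι'' A'' b'' =>
        refine le_eqVal_mk (fun i Δ hΔ hb => ?_) (fun k Δ hΔ hb => ?_)
        · have h := le_memVal_of_le_eqVal_mk (hΔ.trans h₁) i hb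
          rw [memVal] at h
          refine le_of_le_iSup h fun j Δ₁ hΔ₁ hj => ?_
          have h := le_memVal_of_le_eqVal_mk ((hΔ₁.trans hΔ).trans h₂) j (hj.trans inf_le_left)
          rw [memVal] at h
          refine le_of_le_iSup h fun k Δ₂ hΔ₂ hk => ?_
          exact le_memVal_mk k (hk.trans inf_le_left)
            (ih i ((hΔ₂.trans hj).trans inf_le_right) (hk.trans inf_le_right))
        -- The inductive hypothesis concerns members of `x` in first position, so this inclusion
        -- runs from `z` to `x` with all equalities reversed.
        · rw [eqVal_symm] at h₁ h₂
          have h := le_memVal_of_le_eqVal_mk (hΔ.trans h₂) k hb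
          rw [memVal] at h
          refine le_of_le_iSup h fun j Δ₁ hΔ₁ hj => ?_
          have h := le_memVal_of_le_eqVal_mk ((hΔ₁.trans hΔ).trans h₁) j (hj.trans inf_le_left)
          rw [memVal] at h
          refine le_of_le_iSup h fun i Δ₂ hΔ₂ hi => ?_
          rw [eqVal_symm] at hi hj
          refine le_memVal_mk i (hi.trans inf_le_left) ?_
          rw [eqVal_symm]
          exact ih i (hi.trans inf_le_right) ((hΔ₂.trans hj).trans inf_le_right)

theorem le_eqVal_refl (x : BName B) : Γ ≤ eqVal x x := (eqVal_refl x).symm ▸ le_top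

theorem le_eqVal_symm {x y : BName B} (h : Γ ≤ eqVal x y) : Γ ≤ eqVal y x := eqVal_symm x y ▸ h

theorem le_memVal_congr_left {x y z : BName B} (h : Γ ≤ eqVal x y) (hx : Γ ≤ memVal x z) :
    Γ ≤ memVal y z := by
  cases z with
  | mk ι A b =>
    rw [memVal] at hx
    refine le_of_le_iSup hx fun i Δ hΔ hi => le_memVal_mk i (hi.trans inf_le_left) ?_
    exact le_eqVal_trans (hΔ.trans (le_eqVal_symm h)) (hi.trans inf_le_right)

theorem le_memVal_congr_right {x y z : BName B} (h : Γ ≤ eqVal x y) (hx : Γ ≤ memVal z x) :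
    Γ ≤ memVal z y := by
  cases x with
  | mk ι A b =>
    rw [memVal] at hx
    refine le_of_le_iSup hx fun i Δ hΔ hi => ?_
    exact le_memVal_congr_left (le_eqVal_symm (hi.trans inf_le_right))
      (le_memVal_of_le_eqVal_mk (hΔ.trans h) i (hi.trans inf_le_left))

/-- Names can be mixed along families of pairwise disjoint Boolean values. -/
theorem exists_mixing {ι : Type u} (a : ι → B) (ha : ∀ i j, i ≠ j → a i ⊓ a j = ⊥)
    (x : ι → BName B) : ∃ y : BName B, ∀ i, a i ≤ eqVal y (x i) := by
  have hx : ∀ i, ∃ (κ : Type u) (A : κ → BName B) (b : κ → B), x i = mk κ A b := fun i => by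
    cases x i with
    | mk κ A b => exact ⟨κ, A, b, rfl⟩
  choose κ A b hx using hx
  -- The union of all the names, with the members of `x i` cut down by `a i`. Below `a i` the other
  -- parts vanish by disjointness.
  refine ⟨mk (Σ i, κ i) (fun p => A p.1 p.2) (fun p => a p.1 ⊓ b p.1 p.2), fun i => ?_⟩
  rw [hx]
  refine le_eqVal_mk ?_ fun k Δ hΔ hb => ?_
  · rintro ⟨j, k⟩ Δ hΔ hb
    by_cases hij : i = j
    · subst hij
      exact le_memVal_mk k (hb.trans inf_le_right) (le_eqVal_refl _)
    · exact ((le_inf hΔ (hb.trans inf_le_left)).trans (ha i j hij).le).trans bot_le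
  · exact le_memVal_mk (ι := Σ i, κ i) ⟨i, k⟩ (le_inf hΔ hb) (le_eqVal_refl _)

/-- Some member of one set has no equivalent in the other, and by induction all the equalities that
could match it have value `⊥`. -/
theorem eqVal_checkP_eq_bot {x y : PSet.{u}} (h : ¬ PSet.Equiv x y) :
    eqVal (checkP x : BName B) (checkP y) = ⊥ := by
  induction x generalizing y with
  | mk ι A ih =>
    cases y with
    | mk ι' A' =>
      rw [PSet.Equiv, not_and_or] at h
      rw [checkP, checkP, eqVal_mk, eq_bot_iff]
      push Not at h
      rcases h with ⟨i, h⟩ | ⟨j, h⟩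
      · exact inf_le_left.trans ((iInf_le _ i).trans (by simp [fun j => ih i (h j)]))
      · exact inf_le_right.trans ((iInf_le _ j).trans (by simp [fun i => ih i (h i)]))

theorem eqVal_check_eq_bot {x y : ZFSet.{u}} (h : x ≠ y) :
    eqVal (check x : BName B) (check y) = ⊥ := by
  refine eqVal_checkP_eq_bot fun e => h ?_
  rw [← Quotient.out_eq x, ← Quotient.out_eq y]
  exact Quotient.sound e

/-- A name with fewer than `μ` elements, all of which are equal to names in `H_μ`, is equal to a
name in `H_μ`. -/
theorem exists_hName_mk {μ : Cardinal.{u}} {ι : Type u} (hι : #ι < μ) {A : ι → BName B}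
    (hA : ∀ i, ∃ h : HName B μ, eqVal h.toBName (A i) = ⊤) (b : ι → B) :
    ∃ h : HName B μ, eqVal h.toBName (mk ι A b) = ⊤ := by
  obtain ⟨e⟩ : Nonempty (ι ↪ μ.out) := by
    have h : #ι ≤ #μ.out := by rw [mk_out]; exact hι.le
    exact h
  choose h hh using hA
  let f := Equiv.ofInjective e e.injective
  refine ⟨.mk (Set.range e) (by rwa [mk_range_eq _ e.injective]) (fun i => h (f.symm i))
    (fun i => b (f.symm i)), ?_⟩
  rw [HName.toBName, eq_top_iff]
  refine le_eqVal_mk (fun i Δ _ hb => ?_) fun i Δ _ hb => ?_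
  · exact le_memVal_mk (f.symm i) hb (by rw [hh]; exact le_top)
  · refine le_memVal_mk (f i) (by simpa using hb) (le_eqVal_symm ?_)
    rw [f.symm_apply_apply, hh]; exact le_top

/-- Every name is equal to a name in `H_μ` for all large enough `μ`. -/
theorem exists_hName (x : BName B) :
    ∃ μ₀ : Cardinal.{u}, ∀ μ, μ₀ ≤ μ → ∃ h : HName B μ, eqVal h.toBName x = ⊤ := by
  induction x with
  | mk ι A b ih =>
    choose m hm using ih
    refine ⟨max (Order.succ #ι) (⨆ i, m i), fun μ hμ => exists_hName_mk ?_ (fun i => hm i μ ?_) b⟩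
    · exact Order.succ_le_iff.1 ((le_max_left _ _).trans hμ)
    · exact ((le_ciSup bddAbove_of_small i).trans (le_max_right _ _)).trans hμ

end BName

/-! ## The generic term model of an arbitrary family of sets of formulas -/

section TermModel

open BName

variable {L : RelSignature.{u}} {κ : Cardinal.{u}} (S : Set (Set (PreFormula L κ)))
  (code : L.Const ↪ ZFSet.{u})

theorem memVal_domName (x : BName (RO (Cond S))) :
    memVal x (domName S code) = ⨆ c, eqVal x (className S code c) := by
  simp [domName, memVal]

theorem memVal_className_domName (c : L.Const) :
    memVal (className S code c) (domName S code) = ⊤ :=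
  memVal_of_eqVal_className S code _ c (eqVal_refl _)

/-- An element of the generic term model is determined by the codes of constants in it. -/
theorem eqVal_codes_eq_top {σ : BName (RO (Cond S))} (hσ : memVal σ (domName S code) = ⊤) :
    eqVal (.mk L.Const (fun d => check (code d)) (fun d => memVal (check (code d)) σ)) σ = ⊤ := by
  rw [eq_top_iff]
  have h := hσ.ge
  rw [memVal_domName] at h
  -- Below the value of `σ = [c]`, both sides can be compared with `[c]`, whose members are codes by
  -- construction.
  refine le_of_le_iSup h fun c Γ _ hΓ => le_eqVal_trans ?_ (le_eqVal_symm hΓ)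
  refine le_eqVal_mk (fun d Δ hΔ hd => le_memVal_congr_right (hΔ.trans hΓ) hd) fun d Δ hΔ hd => ?_
  refine le_memVal_mk d ?_ (le_eqVal_refl _)
  exact le_memVal_congr_right (hΔ.trans (le_eqVal_symm hΓ)) (le_memVal_mk d hd (le_eqVal_refl _))

theorem exists_isBigEnough : ∃ μ : Cardinal.{u}, μ.IsRegular ∧ IsBigEnough S code μ := by
  choose m hm using fun d : L.Const => exists_hName (check (code d) : BName (RO (Cond S)))
  -- `ℵ₀` makes the successor regular, `#L.Const` bounds the size of a name built from codes, and
  -- the supremum bounds the names of the codes themselves.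
  let ν := max ℵ₀ (max #L.Const (⨆ d, m d))
  have hν : ∀ d, m d ≤ Order.succ ν := fun d =>
    (((le_ciSup bddAbove_of_small d).trans (le_max_right _ _)).trans
      (le_max_right _ _)).trans (Order.le_succ _)
  refine ⟨Order.succ ν, isRegular_succ (le_max_left _ _), fun σ hσ => ?_⟩
  obtain ⟨h, hh⟩ := exists_hName_mk
    (Order.lt_succ_iff.2 ((le_max_left _ _).trans (le_max_right _ _)))
    (fun d => hm d _ (hν d)) (fun d => memVal (check (code d)) σ)
  exact ⟨h, eq_top_iff.2 (le_eqVal_trans hh.ge (eqVal_codes_eq_top S code hσ).ge)⟩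

variable {S code}

theorem le_relVal_congr {Γ : RO (Cond S)} {n : ℕ} {R : L.Rel n} {σ τ : Fin n → BName (RO (Cond S))}
    (h : ∀ i, Γ ≤ eqVal (σ i) (τ i)) (hσ : Γ ≤ relVal S code R σ) : Γ ≤ relVal S code R τ := by
  rw [relVal] at hσ
  refine le_of_le_iSup hσ fun c Δ hΔ hc => ?_
  refine le_iSup_of_le c (le_inf (le_iInf fun i => ?_) (hc.trans inf_le_right))
  exact le_eqVal_trans (hΔ.trans (le_eqVal_symm (h i)))
    ((hc.trans inf_le_left).trans (iInf_le _ i))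

theorem le_eqVal_evalName {Γ : RO (Cond S)} {v w : κ.out → BName (RO (Cond S))}
    (h : ∀ x, Γ ≤ eqVal (v x) (w x)) (t : Tm L κ) :
    Γ ≤ eqVal (evalName S code v t) (evalName S code w t) := by
  cases t with
  | var x => exact h x
  | const c => exact le_eqVal_refl _

theorem le_satVal_congr (φ : PreFormula L κ) {Γ : RO (Cond S)} {v w : κ.out → BName (RO (Cond S))}
    (h : ∀ x, Γ ≤ eqVal (v x) (w x)) (hφ : Γ ≤ satVal S code v φ) : Γ ≤ satVal S code w φ := by
  induction φ generalizing Γ v w with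
  | eq t₁ t₂ =>
    rw [satVal] at hφ ⊢
    exact le_eqVal_trans (le_eqVal_symm (le_eqVal_evalName h t₁))
      (le_eqVal_trans hφ (le_eqVal_evalName h t₂))
  | rel R t =>
    rw [satVal] at hφ ⊢
    exact le_relVal_congr (fun i => le_eqVal_evalName h (t i)) hφ
  | neg φ ih =>
    rw [satVal] at hφ ⊢
    refine le_compl_of_forall fun Δ hΔ hw => le_bot_of_le_compl (hΔ.trans hφ) ?_
    exact ih (fun x => hΔ.trans (le_eqVal_symm (h x))) hw
  | conj I φ ih =>
    rw [satVal] at hφ ⊢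
    exact le_iInf fun i => ih i h (hφ.trans (iInf_le _ i))
  | disj I φ ih =>
    rw [satVal] at hφ ⊢
    exact le_of_le_iSup hφ fun i Δ hΔ hi =>
      le_iSup_of_le i (ih i (fun x => hΔ.trans (h x)) hi)
  | all V φ ih =>
    rw [satVal] at hφ ⊢
    refine le_iInf fun a => le_himp_of_forall fun Δ hΔ ha => ?_
    refine ih (fun x => ?_) (le_of_le_himp (hΔ.trans (hφ.trans (iInf_le _ a))) ha)
    split
    · exact le_eqVal_refl _
    · exact hΔ.trans (h x)
  | ex V φ ih =>
    rw [satVal] at hφ ⊢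
    refine le_of_le_iSup hφ fun a Δ hΔ ha => le_iSup_of_le a (le_inf (ha.trans inf_le_left) ?_)
    refine ih (fun x => ?_) (ha.trans inf_le_right)
    split
    · exact le_eqVal_refl _
    · exact hΔ.trans (h x)

theorem satVal_congr {φ : PreFormula L κ} {v w : κ.out → BName (RO (Cond S))}
    (h : ∀ x, eqVal (v x) (w x) = ⊤) : satVal S code v φ = satVal S code w φ :=
  le_antisymm (le_satVal_congr φ (fun x => (h x).symm ▸ le_top) le_rfl)
    (le_satVal_congr φ (fun x => le_eqVal_symm ((h x).symm ▸ le_top)) le_rfl)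

/-- Finiteness of `V` matters here: it lets the infimum distribute over the suprema in an algebra
that need not be completely distributive. -/
theorem iInf_memVal_domName {V : Finset κ.out} (a : V → BName (RO (Cond S))) :
    ⨅ x, memVal (a x) (domName S code) =
      ⨆ c : V → L.Const, ⨅ x, eqVal (a x) (className S code (c x)) := by
  simp only [memVal_domName]
  exact iInf_iSup_eq_of_finite

open Classical in
/-- Quantifiers over the generic term model are quantifiers over the classes of constants. -/
theorem satVal_all (v : κ.out → BName (RO (Cond S))) (V : Finset κ.out) (φ : PreFormula L κ) :
    satVal S code v (.all V φ) = ⨅ c : V → L.Const,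
      satVal S code (fun x => if h : x ∈ V then className S code (c ⟨x, h⟩) else v x) φ := by
  rw [satVal]
  refine le_antisymm (le_iInf fun c => ?_) (le_iInf fun a => le_himp_of_forall fun Δ hΔ ha => ?_)
  · refine (iInf_le _ (fun x => className S code (c x))).trans ?_
    simp [memVal_className_domName]
  · rw [iInf_memVal_domName] at ha
    refine le_of_le_iSup ha fun c Δ₁ hΔ₁ hc => ?_
    refine le_satVal_congr φ (fun x => ?_) ((hΔ₁.trans hΔ).trans (iInf_le _ c))
    split
    · exact le_eqVal_symm (hc.trans (iInf_le _ _))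
    · exact le_eqVal_refl _

open Classical in
theorem satVal_ex (v : κ.out → BName (RO (Cond S))) (V : Finset κ.out) (φ : PreFormula L κ) :
    satVal S code v (.ex V φ) = ⨆ c : V → L.Const,
      satVal S code (fun x => if h : x ∈ V then className S code (c ⟨x, h⟩) else v x) φ := by
  rw [satVal]
  refine le_antisymm (iSup_le fun a => ?_) (iSup_le fun c => ?_)
  · rw [iInf_memVal_domName, iSup_inf_eq]
    refine iSup_mono fun c => le_satVal_congr φ (fun x => ?_) inf_le_right
    split
    · exact inf_le_left.trans (iInf_le _ _)
    · exact le_eqVal_refl _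
  · refine le_iSup_of_le (fun x => className S code (c x)) ?_
    simp [memVal_className_domName]

/-! ### The structure `A_S`: mixing and agreement with `V^B` -/

variable {μ : Cardinal.{u}} {hμ : IsBigEnough S code μ}

theorem exists_termModelName_eq {σ : BName (RO (Cond S))} (hσ : memVal σ (domName S code) = ⊤) :
    ∃ a : (termModel S code μ hμ).carrier, eqVal (termModelName S code a) σ = ⊤ := by
  obtain ⟨τ, hτ⟩ := hμ σ hσ
  exact ⟨⟨τ, eq_top_iff.2 (le_memVal_congr_left (le_eqVal_symm hτ.ge) hσ.ge)⟩, hτ⟩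

theorem memVal_termModelName (a : (termModel S code μ hμ).carrier) :
    memVal (termModelName S code a) (domName S code) = ⊤ := a.2

theorem eqVal_termModelName_const (c : L.Const) :
    eqVal (termModelName S code ((termModel S code μ hμ).const c)) (className S code c) = ⊤ :=
  (hμ (className S code c)
    (memVal_of_eqVal_className S code _ c (eqVal_refl _))).choose_spec

theorem termModel_isModel [Nonempty L.Const] : (termModel S code μ hμ).IsModel where
  nonempty := ⟨(termModel S code μ hμ).const (Classical.arbitrary _)⟩
  refl _ := eqVal_refl _
  symm _ _ := eqVal_symm _ _
  trans _ _ _ := le_eqVal_trans inf_le_left inf_le_right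
  subst _ _ _ := le_relVal_congr (fun i => inf_le_left.trans (iInf_le _ i)) inf_le_right

/-- Names which are partially elements of the generic term model extend to elements of `A_S`. -/
theorem exists_mixing_termModel [Nonempty L.Const] {ι : Type u} (a : ι → RO (Cond S))
    (ha : ∀ i j, i ≠ j → a i ⊓ a j = ⊥) (σ : ι → BName (RO (Cond S)))
    (hσ : ∀ i, a i ≤ memVal (σ i) (domName S code)) :
    ∃ t : (termModel S code μ hμ).carrier, ∀ i, a i ≤ eqVal (termModelName S code t) (σ i) := by
  -- The extra index `none` assigns the class of an arbitrary constant to the complement of `⨆ i, a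
  -- i`, so that the mixture lies in `A_G` with value `⊤`.
  obtain ⟨y, hy⟩ := exists_mixing (ι := Option ι) (fun o => o.elim (⨆ i, a i)ᶜ a)
    (by
      have h : ∀ i, a i ⊓ (⨆ i, a i)ᶜ = ⊥ := fun i =>
        (disjoint_compl_right.mono_left (le_iSup a i)).eq_bot
      rintro (_ | i) (_ | j) hij
      · exact absurd rfl hij
      · exact (inf_comm _ _).trans (h j)
      · exact h i
      · exact ha i j fun e => hij (e ▸ rfl))
    (fun o => o.elim (className S code (Classical.arbitrary _)) σ)
  have hm : memVal y (domName S code) = ⊤ := by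
    rw [eq_top_iff, ← sup_compl_eq_top (x := ⨆ i, a i)]
    refine sup_le (iSup_le fun i => ?_) ?_
    · exact le_memVal_congr_left (le_eqVal_symm (hy (some i))) (hσ i)
    · exact le_memVal_congr_left (le_eqVal_symm (hy none))
        (le_top.trans (memVal_className_domName S code _).ge)
  obtain ⟨t, ht⟩ := exists_termModelName_eq (hμ := hμ) hm
  exact ⟨t, fun i => le_eqVal_trans (le_top.trans ht.ge) (hy (some i))⟩

theorem termModel_mixing [Nonempty L.Const] : (termModel S code μ hμ).Mixing := by
  intro A hA τ
  exact exists_mixing_termModel (hμ := hμ) (fun a : A => (a : RO (Cond S)))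
    (fun a b hab => hA a a.2 b b.2 fun e => hab (Subtype.ext e))
    (fun a => termModelName S code (τ a)) fun a => le_top.trans (memVal_termModelName _).ge

theorem eqVal_evalTm (v : κ.out → (termModel S code μ hμ).carrier) (t : Tm L κ) :
    eqVal (termModelName S code ((termModel S code μ hμ).evalTm v t))
      (evalName S code (fun x => termModelName S code (v x)) t) = ⊤ := by
  cases t with
  | var x => exact eqVal_refl _
  | const c => exact eqVal_termModelName_const c

open Classical in
/-- Formulas have the same value in `A_S` and, relativized to the generic term model, in `V^B`. -/
theorem val_eq_satVal [Nonempty L.Const] (φ : PreFormula L κ)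
    (v : κ.out → (termModel S code μ hμ).carrier) :
    (termModel S code μ hμ).val v φ = satVal S code (fun x => termModelName S code (v x)) φ := by
  have hupd : ∀ (V : Finset κ.out) (w : κ.out → (termModel S code μ hμ).carrier)
      (a : V → (termModel S code μ hμ).carrier),
      (fun x => termModelName S code (if h : x ∈ V then a ⟨x, h⟩ else w x)) =
        fun x => if h : x ∈ V then termModelName S code (a ⟨x, h⟩)
          else termModelName S code (w x) := fun V w a => by
    funext x; split <;> rfl
  induction φ generalizing v with
  | eq t₁ t₂ =>
    rw [BValStructure.val, satVal]
    have h₁ := fun Γ : RO (Cond S) => (le_top (a := Γ)).trans (eqVal_evalTm v t₁).ge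
    have h₂ := fun Γ : RO (Cond S) => (le_top (a := Γ)).trans (eqVal_evalTm v t₂).ge
    exact le_antisymm (le_eqVal_trans (le_eqVal_symm (h₁ _)) (le_eqVal_trans le_rfl (h₂ _)))
      (le_eqVal_trans (h₁ _) (le_eqVal_trans le_rfl (le_eqVal_symm (h₂ _))))
  | rel R t =>
    rw [BValStructure.val, satVal]
    have h := fun (Γ : RO (Cond S)) i => (le_top (a := Γ)).trans (eqVal_evalTm v (t i)).ge
    exact le_antisymm (le_relVal_congr (h _) le_rfl)
      (le_relVal_congr (fun i => le_eqVal_symm (h _ i)) le_rfl)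
  | neg φ ih => rw [BValStructure.val, satVal, ih]
  | conj I φ ih => rw [BValStructure.val, satVal]; exact iInf_congr fun i => ih i v
  | disj I φ ih => rw [BValStructure.val, satVal]; exact iSup_congr fun i => ih i v
  | all V φ ih =>
    rw [BValStructure.val, satVal_all]
    simp only [ih, hupd]
    refine le_antisymm (le_iInf fun c => ?_) (le_iInf fun a => ?_)
    · refine (iInf_le _ fun x => (termModel S code μ hμ).const (c x)).trans (satVal_congr ?_).le
      intro x
      split
      · exact eqVal_termModelName_const _
      · exact eqVal_refl _
    -- Returning to the relativized quantifier over all names, the elements of `A_S` are admissible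
    -- instances with guard `⊤`.
    · rw [← satVal_all, satVal]
      exact (iInf_le _ fun x => termModelName S code (a x)).trans (by simp [memVal_termModelName])
  | ex V φ ih =>
    rw [BValStructure.val, satVal_ex]
    simp only [ih, hupd]
    refine le_antisymm (iSup_le fun a => ?_) (iSup_le fun c => ?_)
    · rw [← satVal_ex, satVal]
      exact le_iSup_of_le (fun x => termModelName S code (a x)) (by simp [memVal_termModelName])
    · refine le_iSup_of_le (fun x => (termModel S code μ hμ).const (c x)) (satVal_congr ?_).le
      intro x
      split
      · exact eqVal_symm _ _ |>.trans (eqVal_termModelName_const _)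
      · exact eqVal_refl _

end TermModel

/-! ## Density arguments in regular open algebras -/

namespace RO

variable {P : Type u} [Preorder P] {p q : P} {a b : RO P}

theorem reg_le_iff : reg p ≤ b ↔ p ∈ Heyting.Regular.val b :=
  (Heyting.Regular.gi.gc (LowerSet.Iic p) b).trans LowerSet.Iic_le

theorem reg_mono (h : p ≤ q) : reg p ≤ reg q :=
  Heyting.Regular.toRegular.monotone (LowerSet.Iic_le.2 h)

theorem le_of_forall_reg (h : ∀ p, reg p ≤ a → reg p ≤ b) : a ≤ b := by
  have h' : Heyting.Regular.val a ≤ Heyting.Regular.val b := fun p hp =>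
    reg_le_iff.1 (h p (reg_le_iff.2 hp))
  exact h'

theorem not_reg_le_bot : ¬ reg p ≤ ⊥ := fun h => by
  have h' : p ∈ (⊥ : LowerSet P) := reg_le_iff.1 h
  exact h'

theorem reg_le_compl (h : ∀ q ≤ p, ¬ reg q ≤ b) : reg p ≤ bᶜ := by
  have h' : LowerSet.Iic p ≤ (Heyting.Regular.val b)ᶜ := by
    rw [le_compl_iff_disjoint_right, disjoint_iff_inf_le]
    rintro q ⟨hq, hb⟩
    exact h q hq (reg_le_iff.2 hb)
  exact reg_le_iff.2 (LowerSet.Iic_le.1 h')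

/-- A regular element is its own double complement, so no `q ≤ p` can lie in the complement of `b`
once some extension of each `q` lies in `b`. -/
theorem reg_le_of_dense (h : ∀ q ≤ p, ∃ r ≤ q, reg r ≤ b) : reg p ≤ b := by
  rw [← compl_compl b]
  refine reg_le_compl fun q hq hb => ?_
  obtain ⟨r, hr, hrb⟩ := h q hq
  exact not_reg_le_bot (le_bot_of_le_compl ((reg_mono hr).trans hb) hrb)

/-- If `p` and `q` were incompatible, the cone of `q` would lie both in the complement of the cone
of `p` and in its double complement. -/
theorem exists_le_of_reg_le (h : reg q ≤ reg p) : ∃ r ≤ q, r ≤ p := by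
  by_contra hr
  push Not at hr
  have h₁ : LowerSet.Iic q ≤ (LowerSet.Iic p)ᶜ := by
    rw [le_compl_iff_disjoint_right, disjoint_iff_inf_le]
    rintro r ⟨hq, hp⟩
    exact hr r hq hp
  have h₂ : LowerSet.Iic q ≤ (LowerSet.Iic p)ᶜᶜ := LowerSet.Iic_le.2 (reg_le_iff.1 h)
  have h₃ : q ∈ (LowerSet.Iic p)ᶜ ⊓ (LowerSet.Iic p)ᶜᶜ :=
    ⟨LowerSet.Iic_le.1 h₁, LowerSet.Iic_le.1 h₂⟩
  rw [inf_compl_self] at h₃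
  exact h₃

theorem nontrivial [Nonempty P] : Nontrivial (RO P) :=
  ⟨⊥, ⊤, fun h => not_reg_le_bot (p := Classical.arbitrary P) (le_top.trans h.ge)⟩

end RO

/-! ### The generic set of formulas -/

section Sigma

variable {L : RelSignature.{u}} {κ : Cardinal.{u}} {S : Set (Set (PreFormula L κ))}
  {φ ψ : PreFormula L κ}

theorem reg_le_sigmaVal {p : Cond S} (h : φ ∈ p.1) : RO.reg p ≤ sigmaVal S φ :=
  le_iSup (fun p : {p : Cond S // φ ∈ p.1} => RO.reg p.1) ⟨p, h⟩

/-- Otherwise `p` is incompatible with every condition containing `φ`, and so lies below the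
complement of their supremum. -/
theorem exists_mem_of_reg_le_sigmaVal {p : Cond S} (h : RO.reg p ≤ sigmaVal S φ) :
    ∃ q ≤ p, φ ∈ q.1 := by
  by_contra hq
  push Not at hq
  refine RO.not_reg_le_bot (p := p) (le_bot_of_le_compl ?_ h)
  rw [sigmaVal, compl_iSup]
  refine le_iInf fun r => RO.reg_le_compl fun q hqp hqr => ?_
  obtain ⟨t, htq, htr⟩ := RO.exists_le_of_reg_le hqr
  exact hq t (htq.trans hqp) (htr r.2)

/-- This turns closure clauses into Boolean inequalities. Any `q ≤ p` sits inside some `s ∈ S`, and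
`q ∪ {χ j}` is again a condition because subsets of elements of `S` are allowed. -/
theorem reg_le_iSup_sigmaVal {ι : Sort*} {χ : ι → PreFormula L κ} {p : Cond S}
    (h : ∀ s ∈ S, p.1 ⊆ s → ∃ j, s ∪ {χ j} ∈ S) : RO.reg p ≤ ⨆ j, sigmaVal S (χ j) := by
  refine RO.reg_le_of_dense fun q hq => ?_
  obtain ⟨s, hs, hqs⟩ := q.2
  obtain ⟨j, hj⟩ := h s hs (Set.Subset.trans hq hqs)
  refine ⟨⟨q.1 ∪ {χ j}, _, hj, Set.union_subset_union_left _ hqs⟩, Set.subset_union_left, ?_⟩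
  exact le_iSup_of_le j (reg_le_sigmaVal (Set.mem_union_right _ rfl))

theorem sigmaVal_inf_le {b : RO (Cond S)} (h : ∀ p : Cond S, φ ∈ p.1 → ψ ∈ p.1 → RO.reg p ≤ b) :
    sigmaVal S φ ⊓ sigmaVal S ψ ≤ b := by
  refine RO.le_of_forall_reg fun p hp => RO.reg_le_of_dense fun q hq => ?_
  obtain ⟨r, hr, hφ⟩ := exists_mem_of_reg_le_sigmaVal
    ((RO.reg_mono hq).trans (hp.trans inf_le_left))
  obtain ⟨t, ht, hψ⟩ := exists_mem_of_reg_le_sigmaVal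
    ((RO.reg_mono (hr.trans hq)).trans (hp.trans inf_le_right))
  exact ⟨t, ht.trans hr, h t (ht hφ) hψ⟩

theorem sigmaVal_le_iSup {ι : Sort*} {χ : ι → PreFormula L κ}
    (h : ∀ s ∈ S, φ ∈ s → ∃ j, s ∪ {χ j} ∈ S) : sigmaVal S φ ≤ ⨆ j, sigmaVal S (χ j) :=
  iSup_le fun p => reg_le_iSup_sigmaVal fun s hs hps => h s hs (hps p.2)

theorem sigmaVal_le (h : ∀ s ∈ S, φ ∈ s → s ∪ {ψ} ∈ S) : sigmaVal S φ ≤ sigmaVal S ψ :=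
  (sigmaVal_le_iSup (χ := fun _ : Unit => ψ) fun s hs hφ => ⟨(), h s hs hφ⟩).trans
    (iSup_le fun _ => le_rfl)

theorem sigmaVal_eq_bot (h : ∀ s ∈ S, φ ∉ s) : sigmaVal S φ = ⊥ := by
  refine eq_bot_iff.2 (iSup_le fun p => ?_)
  obtain ⟨s, hs, hps⟩ := p.1.2
  exact absurd (hps p.2) (h s hs)

/-- A formula in all elements of `S` belongs to the generic set of formulas. -/
theorem sigmaVal_eq_top (h : ∀ s ∈ S, φ ∈ s) : sigmaVal S φ = ⊤ := by
  refine eq_top_iff.2 (RO.le_of_forall_reg fun p _ => ?_)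
  exact (reg_le_iSup_sigmaVal (χ := fun _ : Unit => φ) fun s hs _ =>
    ⟨(), by rwa [Set.union_singleton, Set.insert_eq_of_mem (h s hs)]⟩).trans
      (iSup_le fun _ => le_rfl)

end Sigma

/-! ## Substitution -/

section Subst

variable {L : RelSignature.{u}} {κ : Cardinal.{u}}

theorem Tm.subst_subst (ρ ρ' : κ.out → Option L.Const) (t : Tm L κ) :
    (t.subst ρ).subst ρ' = t.subst fun x => (ρ x).or (ρ' x) := by
  cases t with
  | var x => cases h : ρ x <;> simp [Tm.subst, h]
  | const c => rfl

theorem PreFormula.subst_subst (φ : PreFormula L κ) (ρ ρ' : κ.out → Option L.Const) :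
    (φ.subst ρ).subst ρ' = φ.subst fun x => (ρ x).or (ρ' x) := by
  have hV : ∀ (V : Finset κ.out) (ρ ρ' : κ.out → Option L.Const) x, [Decidable (x ∈ V)] →
      ((if x ∈ V then none else ρ x).or (if x ∈ V then none else ρ' x)) =
        if x ∈ V then none else (ρ x).or (ρ' x) := fun V ρ ρ' x _ => by split <;> rfl
  induction φ generalizing ρ ρ' with
  | eq t₁ t₂ => simp only [PreFormula.subst, Tm.subst_subst]
  | rel R t => simp only [PreFormula.subst, Tm.subst_subst]
  | neg φ ih => simp only [PreFormula.subst, ih]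
  | conj I φ ih => simp only [PreFormula.subst, ih]
  | disj I φ ih => simp only [PreFormula.subst, ih]
  | all V φ ih => simp only [PreFormula.subst, ih, hV]
  | ex V φ ih => simp only [PreFormula.subst, ih, hV]

theorem Tm.subst_none (t : Tm L κ) : t.subst (fun _ => none) = t := by
  cases t <;> rfl

theorem PreFormula.subst_none (φ : PreFormula L κ) : φ.subst (fun _ => none) = φ := by
  induction φ with
  | eq t₁ t₂ => simp only [PreFormula.subst, Tm.subst_none]
  | rel R t => simp only [PreFormula.subst, Tm.subst_none]
  | neg φ ih => simp only [PreFormula.subst, ih]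
  | conj I φ ih => simp only [PreFormula.subst, ih]
  | disj I φ ih => simp only [PreFormula.subst, ih]
  | all V φ ih => simp only [PreFormula.subst, ite_self, ih]
  | ex V φ ih => simp only [PreFormula.subst, ite_self, ih]

open Classical in
/-- Instantiating the body of a quantified substitution instance. -/
theorem PreFormula.inst_subst (φ : PreFormula L κ) (V : Finset κ.out) (c : V → L.Const)
    (ρ : κ.out → Option L.Const) :
    (φ.subst fun x => if x ∈ V then none else ρ x).inst V c =
      φ.subst fun x => if h : x ∈ V then some (c ⟨x, h⟩) else ρ x := by
  rw [PreFormula.inst, PreFormula.subst_subst]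
  congr 1
  funext x
  by_cases h : x ∈ V <;> simp [h]

end Subst

/-! ## The generic term model of a consistency property -/

namespace IsConsistencyProperty

open BName

variable {L : RelSignature.{u}} {C : Type u} {κ : Cardinal.{u}}
  {S : Set (Set (PreFormula (L.withConsts C) κ))} (hS : IsConsistencyProperty L C κ S)
  {φ : PreFormula (L.withConsts C) κ}

/-- The elements of a consistency property which extend a given set. -/
theorem extensions (hS : IsConsistencyProperty L C κ S)
    (s : Set (PreFormula (L.withConsts C) κ)) :
    IsConsistencyProperty L C κ {t ∈ S | s ⊆ t} := by
  -- The closure clauses only ever enlarge `t`, so the result still contains `s`.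
  have hU : ∀ {t r : Set (PreFormula (L.withConsts C) κ)}, t ∈ {t ∈ S | s ⊆ t} → t ∪ r ∈ S →
      t ∪ r ∈ {t ∈ S | s ⊆ t} := fun ht h => ⟨h, ht.2.trans Set.subset_union_left⟩
  exact
  { sentences := fun t ht => hS.sentences t ht.1
    con := fun t ht => hS.con t ht.1
    ind1 := fun t ht φ h => hU ht (hS.ind1 t ht.1 φ h)
    ind2 := fun t ht I φ h i => hU ht (hS.ind2 t ht.1 I φ h i)
    ind3 := fun t ht V φ h c => hU ht (hS.ind3 t ht.1 V φ h c)
    ind4 := fun t ht I φ h => (hS.ind4 t ht.1 I φ h).imp fun _ => hU ht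
    ind5 := fun t ht V φ h => (hS.ind5 t ht.1 V φ h).imp fun _ => hU ht
    str1 := fun t ht c d h => hU ht (hS.str1 t ht.1 c d h)
    str2 := fun t ht c d φ x h h' => hU ht (hS.str2 t ht.1 c d φ x h h')
    str3 := fun t ht d => (hS.str3 t ht.1 d).imp fun _ => hU ht }

include hS

theorem sigmaVal_neg_le : sigmaVal S (.neg φ) ≤ (sigmaVal S φ)ᶜ := by
  rw [le_compl_iff_disjoint_right, disjoint_iff_inf_le]
  refine sigmaVal_inf_le fun p hn hp => ?_
  obtain ⟨s, hs, hps⟩ := p.2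
  exact absurd (hS.con s hs φ) (by simp [hps hn, hps hp])

theorem sigmaVal_neg_le_negIn : sigmaVal S (.neg φ) ≤ sigmaVal S φ.negIn :=
  sigmaVal_le fun s hs h => hS.ind1 s hs φ h

theorem sigmaVal_conj_le {I : Set κ.out} {φ : I → PreFormula (L.withConsts C) κ} (i : I) :
    sigmaVal S (.conj I φ) ≤ sigmaVal S (φ i) :=
  sigmaVal_le fun s hs h => hS.ind2 s hs I φ h i

theorem sigmaVal_disj_le {I : Set κ.out} {φ : I → PreFormula (L.withConsts C) κ} :
    sigmaVal S (.disj I φ) ≤ ⨆ i, sigmaVal S (φ i) :=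
  sigmaVal_le_iSup fun s hs h => hS.ind4 s hs I φ h

theorem sigmaVal_all_le {V : Finset κ.out} (c : V → (L.withConsts C).Const) :
    sigmaVal S (.all V φ) ≤ sigmaVal S (φ.inst V c) :=
  sigmaVal_le fun s hs h => hS.ind3 s hs V φ h c

theorem sigmaVal_ex_le {V : Finset κ.out} :
    sigmaVal S (.ex V φ) ≤ ⨆ c : V → (L.withConsts C).Const, sigmaVal S (φ.inst V c) :=
  sigmaVal_le_iSup fun s hs h => by
    obtain ⟨c, hc⟩ := hS.ind5 s hs V φ h
    exact ⟨fun x => Sum.inr (c x), hc⟩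

theorem sigmaVal_eq_symm (c d : (L.withConsts C).Const) :
    sigmaVal S (.eq (.const c) (.const d)) ≤ sigmaVal S (.eq (.const d) (.const c)) :=
  sigmaVal_le fun s hs h => hS.str1 s hs c d h

theorem sigmaVal_inst₁_le (c d : (L.withConsts C).Const) (x : κ.out) :
    sigmaVal S (.eq (.const c) (.const d)) ⊓ sigmaVal S (φ.inst₁ x d) ≤
      sigmaVal S (φ.inst₁ x c) :=
  sigmaVal_inf_le fun _ h h' =>
    (reg_le_iSup_sigmaVal (χ := fun _ : Unit => φ.inst₁ x c) fun s hs hps =>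
      ⟨(), hS.str2 s hs c d φ x (hps h) (hps h')⟩).trans (iSup_le fun _ => le_rfl)

theorem sigmaVal_eq_trans (hκ : ℵ₀ ≤ κ) (c d e : (L.withConsts C).Const) :
    sigmaVal S (.eq (.const c) (.const d)) ⊓ sigmaVal S (.eq (.const d) (.const e)) ≤
      sigmaVal S (.eq (.const c) (.const e)) := by
  have hκ' : #κ.out ≠ 0 := by rw [mk_out]; exact (aleph0_pos.trans_le hκ).ne'
  obtain ⟨x⟩ := mk_ne_zero_iff.1 hκ'
  -- (Str.2) applied to the formula `x = e`.
  have h := hS.sigmaVal_inst₁_le (φ := .eq (.var x) (.const e)) c d x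
  simpa [PreFormula.inst₁, PreFormula.inst, PreFormula.subst, Tm.subst] using h

/-- (Str.3) supplies a constant `c` with `c = d`; symmetry and transitivity then give `d = d`. -/
theorem sigmaVal_eq_refl (hκ : ℵ₀ ≤ κ) (d : (L.withConsts C).Const) :
    sigmaVal S (.eq (.const d) (.const d)) = ⊤ := by
  have h : (⊤ : RO (Cond S)) ≤ ⨆ c : C, sigmaVal S (.eq (.const (Sum.inr c)) (.const d)) :=
    RO.le_of_forall_reg fun p _ => reg_le_iSup_sigmaVal fun s hs _ => hS.str3 s hs d
  refine eq_top_iff.2 (h.trans (iSup_le fun c => ?_))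
  exact (le_inf (hS.sigmaVal_eq_symm _ _) le_rfl).trans (hS.sigmaVal_eq_trans hκ _ _ _)

theorem eqVal_className (hκ : ℵ₀ ≤ κ) (code : (L.withConsts C).Const ↪ ZFSet.{u})
    (c d : (L.withConsts C).Const) :
    eqVal (className S code c) (className S code d) =
      sigmaVal S (.eq (.const c) (.const d)) := by
  refine le_antisymm ?_ (le_eqVal_mk (fun e Δ hΔ he => ?_) fun e Δ hΔ he => ?_)
  -- Reflexivity puts the code of `d` in `[d]`, hence in `[c]`. Distinct codes are equal with value
  -- `⊥`, so only the term `e = d` of the supremum survives.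
  · have hd := hS.sigmaVal_eq_refl hκ d
    refine (le_memVal_of_le_eqVal_mk (le_eqVal_symm le_rfl) d (hd ▸ le_top)).trans ?_
    rw [className, memVal]
    refine iSup_le fun e => ?_
    by_cases hde : d = e
    · exact hde ▸ inf_le_left
    · rw [eqVal_check_eq_bot (code.injective.ne hde), inf_bot_eq]
      exact bot_le
  · refine le_memVal_mk e ?_ (le_eqVal_refl _)
    exact (le_inf (hΔ.trans (hS.sigmaVal_eq_symm _ _)) he).trans (hS.sigmaVal_eq_trans hκ _ _ _)
  · refine le_memVal_mk e ?_ (le_eqVal_refl _)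
    exact (le_inf hΔ he).trans (hS.sigmaVal_eq_trans hκ _ _ _)

-- (Str.2) replaces one constant at a time; the induction is over the set `F` of coordinates already
-- replaced.
open Classical in
theorem sigmaVal_rel_congr (hκ : ℵ₀ ≤ κ) {n : ℕ} (R : (L.withConsts C).Rel n)
    (c d : Fin n → (L.withConsts C).Const) :
    (⨅ i, sigmaVal S (.eq (.const (c i)) (.const (d i)))) ⊓
      sigmaVal S (.rel R fun i => .const (d i)) ≤ sigmaVal S (.rel R fun i => .const (c i)) := by
  have hκ' : #κ.out ≠ 0 := by rw [mk_out]; exact (aleph0_pos.trans_le hκ).ne'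
  obtain ⟨x⟩ := mk_ne_zero_iff.1 hκ'
  suffices h : ∀ F : Finset (Fin n), (⨅ i, sigmaVal S (.eq (.const (c i)) (.const (d i)))) ⊓
      sigmaVal S (.rel R fun i => .const (d i)) ≤
        sigmaVal S (.rel R fun i => .const (if i ∈ F then c i else d i)) by
    simpa using h Finset.univ
  intro F
  induction F using Finset.induction_on with
  | empty => simp
  | insert j F hj ih =>
    have h := hS.sigmaVal_inst₁_le (c j) (d j) x
      (φ := .rel R fun i => if i = j then .var x else .const (if i ∈ F then c i else d i))
    have hinst : ∀ e, (PreFormula.rel R fun i => if i = j then .var x else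
        .const (if i ∈ F then c i else d i) : PreFormula (L.withConsts C) κ).inst₁ x e =
          .rel R fun i => .const (if i = j then e else if i ∈ F then c i else d i) := fun e => by
      rw [PreFormula.inst₁, PreFormula.inst, PreFormula.subst]
      congr 1
      funext i
      by_cases hi : i = j <;> simp [hi, Tm.subst]
    rw [hinst, hinst] at h
    have h₁ : (fun i => Tm.const (if i = j then d j else if i ∈ F then c i else d i) :
        Fin n → Tm (L.withConsts C) κ) = fun i => .const (if i ∈ F then c i else d i) := by
      funext i
      by_cases hi : i = j
      · subst hi; simp [hj]
      · simp [hi]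
    have h₂ : (fun i => Tm.const (if i = j then c j else if i ∈ F then c i else d i) :
        Fin n → Tm (L.withConsts C) κ) =
          fun i => .const (if i ∈ insert j F then c i else d i) := by
      funext i
      by_cases hi : i = j
      · subst hi; simp
      · simp [hi]
    rw [h₁, h₂] at h
    exact (le_inf (inf_le_left.trans (iInf_le _ j)) ih).trans h

theorem relVal_className (hκ : ℵ₀ ≤ κ) (code : (L.withConsts C).Const ↪ ZFSet.{u}) {n : ℕ}
    (R : (L.withConsts C).Rel n) (c : Fin n → (L.withConsts C).Const) :
    relVal S code R (fun i => className S code (c i)) =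
      sigmaVal S (.rel R fun i => .const (c i)) := by
  refine le_antisymm (iSup_le fun d => ?_) (le_iSup_of_le c (le_inf ?_ le_rfl))
  · simp only [hS.eqVal_className hκ]
    exact hS.sigmaVal_rel_congr hκ R c d
  · exact le_iInf fun i => le_eqVal_refl _

theorem sigmaVal_eq_bot_of_freeVars (h : φ.freeVars ≠ ∅) :
    sigmaVal S φ = ⊥ ∧ sigmaVal S (.neg φ) = ⊥ :=
  ⟨sigmaVal_eq_bot fun s hs hφ => h (hS.sentences s hs _ hφ).2,
    sigmaVal_eq_bot fun s hs hφ => h (hS.sentences s hs _ hφ).2⟩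

open Classical in
/-- The generic term model satisfies the formulas in the generic set of formulas. -/
theorem sigmaVal_subst_le_satVal (hκ : ℵ₀ ≤ κ) (code : (L.withConsts C).Const ↪ ZFSet.{u})
    (φ : PreFormula (L.withConsts C) κ) (ρ : κ.out → Option (L.withConsts C).Const)
    (v : κ.out → BName (RO (Cond S))) (hv : ∀ x, ∀ c ∈ ρ x, v x = className S code c) :
    sigmaVal S (φ.subst ρ) ≤ satVal S code v φ ∧
      sigmaVal S (.neg (φ.subst ρ)) ≤ (satVal S code v φ)ᶜ := by
  have hTm : ∀ (ρ : κ.out → Option (L.withConsts C).Const) (v : κ.out → BName (RO (Cond S))),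
      (∀ x, ∀ c ∈ ρ x, v x = className S code c) →
      -- Instances with free variables are harmless: elements of `S` contain only sentences, so such
      -- instances have value `⊥`.
      ∀ t : Tm (L.withConsts C) κ, (t.subst ρ).freeVars = ∅ →
        ∃ c, t.subst ρ = .const c ∧ evalName S code v t = className S code c := by
    intro ρ v hv t ht
    cases t with
    | const c => exact ⟨c, rfl, rfl⟩
    | var x =>
      cases hx : ρ x with
      | none => simp [Tm.subst, hx, Tm.freeVars] at ht
      | some c => exact ⟨c, by simp [Tm.subst, hx], hv x c hx⟩
  have hupd : ∀ (V : Finset κ.out) (c : V → (L.withConsts C).Const)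
      (ρ : κ.out → Option (L.withConsts C).Const) (v : κ.out → BName (RO (Cond S))),
      (∀ x, ∀ c ∈ ρ x, v x = className S code c) →
      ∀ x, ∀ d ∈ (if h : x ∈ V then some (c ⟨x, h⟩) else ρ x),
        (if h : x ∈ V then className S code (c ⟨x, h⟩) else v x) = className S code d := by
    intro V c ρ v hv x d hd
    by_cases h : x ∈ V
    · simp only [h, dite_true, Option.mem_some_iff] at hd ⊢
      rw [hd]
    · simp only [h, dite_false] at hd ⊢
      exact hv x d hd
  -- The substitution `ρ` is general because `φ.inst V c` is not a subformula of the quantified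
  -- formula. By `inst_subst`, instantiating the body just extends `ρ`.
  induction φ generalizing ρ v with
  | eq t₁ t₂ =>
    by_cases h : ((PreFormula.eq t₁ t₂).subst ρ).freeVars = ∅
    · simp only [PreFormula.subst, PreFormula.freeVars, Set.union_empty_iff] at h
      obtain ⟨c₁, h₁, h₁'⟩ := hTm ρ v hv t₁ h.1
      obtain ⟨c₂, h₂, h₂'⟩ := hTm ρ v hv t₂ h.2
      rw [PreFormula.subst, satVal, h₁, h₂, h₁', h₂', hS.eqVal_className hκ]
      exact ⟨le_rfl, hS.sigmaVal_neg_le⟩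
    · simp [hS.sigmaVal_eq_bot_of_freeVars h]
  | rel R t =>
    by_cases h : ((PreFormula.rel R t).subst ρ).freeVars = ∅
    · simp only [PreFormula.subst, PreFormula.freeVars, Set.iUnion_eq_empty] at h
      choose c hc hc' using fun i => hTm ρ v hv (t i) (h i)
      rw [PreFormula.subst, satVal, funext hc, funext hc', hS.relVal_className hκ]
      exact ⟨le_rfl, hS.sigmaVal_neg_le⟩
    · simp [hS.sigmaVal_eq_bot_of_freeVars h]
  | neg φ ih =>
    rw [PreFormula.subst, satVal, compl_compl]
    exact ⟨(ih ρ v hv).2, hS.sigmaVal_neg_le_negIn.trans (ih ρ v hv).1⟩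
  | conj I φ ih =>
    rw [PreFormula.subst, satVal, compl_iInf]
    exact ⟨le_iInf fun i => (hS.sigmaVal_conj_le i).trans (ih i ρ v hv).1,
      hS.sigmaVal_neg_le_negIn.trans
        (hS.sigmaVal_disj_le.trans (iSup_mono fun i => (ih i ρ v hv).2))⟩
  | disj I φ ih =>
    rw [PreFormula.subst, satVal, compl_iSup]
    exact ⟨hS.sigmaVal_disj_le.trans (iSup_mono fun i => (ih i ρ v hv).1),
      le_iInf fun i => hS.sigmaVal_neg_le_negIn.trans
        ((hS.sigmaVal_conj_le i).trans (ih i ρ v hv).2)⟩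
  | all V φ ih =>
    rw [PreFormula.subst, satVal_all, compl_iInf]
    have h := fun c : V → (L.withConsts C).Const => ih _ _ (hupd V c ρ v hv)
    simp only [← PreFormula.inst_subst] at h
    exact ⟨le_iInf fun c => (hS.sigmaVal_all_le c).trans (h c).1,
      hS.sigmaVal_neg_le_negIn.trans (hS.sigmaVal_ex_le.trans (iSup_mono fun c => (h c).2))⟩
  | ex V φ ih =>
    rw [PreFormula.subst, satVal_ex, compl_iSup]
    have h := fun c : V → (L.withConsts C).Const => ih _ _ (hupd V c ρ v hv)
    simp only [← PreFormula.inst_subst] at h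
    exact ⟨hS.sigmaVal_ex_le.trans (iSup_mono fun c => (h c).1),
      le_iInf fun c => hS.sigmaVal_neg_le_negIn.trans ((hS.sigmaVal_all_le c).trans (h c).2)⟩

theorem sigmaVal_le_satVal (hκ : ℵ₀ ≤ κ) (code : (L.withConsts C).Const ↪ ZFSet.{u})
    (φ : PreFormula (L.withConsts C) κ) (v : κ.out → BName (RO (Cond S))) :
    sigmaVal S φ ≤ satVal S code v φ := by
  have h := (hS.sigmaVal_subst_le_satVal hκ code φ (fun _ => none) v (by simp)).1
  rwa [PreFormula.subst_none] at h

end IsConsistencyProperty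

theorem nonempty_embedding_zfSet (α : Type u) : Nonempty (α ↪ ZFSet.{u}) := by
  -- The rank of a von Neumann ordinal recovers the ordinal.
  have hinj : Function.Injective Ordinal.toZFSet.{u} := fun a b h => by
    rw [← Ordinal.rank_toZFSet a, h, Ordinal.rank_toZFSet]
  exact ⟨(embeddingToCardinal.trans ⟨ord, ord_injective⟩).trans ⟨_, hinj⟩⟩

end BVLogic

theorem mainTheorem2 (L : RelSignature.{u}) (C : Type u) [Infinite C] (κ : Cardinal.{u})
    (hκ : ℵ₀ ≤ κ) (hC : #C ≤ κ) (S : Set (Set (PreFormula (L.withConsts C) κ)))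
    (hS : IsConsistencyProperty L C κ S) (hfin : ∀ s ∈ S, s.Finite) :
    (∀ code : (L.withConsts C).Const ↪ ZFSet.{u},
      (∃ μ : Cardinal.{u}, μ.IsRegular ∧ IsBigEnough S code μ) ∧
      ∀ (μ : Cardinal.{u}) (_ : μ.IsRegular) (hμ : IsBigEnough S code μ),
        (termModel S code μ hμ).IsModel ∧
        (termModel S code μ hμ).Mixing ∧
        ∀ (s : Set (PreFormula (L.withConsts C) κ)) (hs : s ∈ S)
          (v : κ.out → (termModel S code μ hμ).carrier),
          (termModel S code μ hμ).val v (bigAnd hκ s (hfin s hs)) =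
            satVal S code (fun x => termModelName S code (v x)) (bigAnd hκ s (hfin s hs))) ∧
    ∀ (s : Set (PreFormula (L.withConsts C) κ)) (hs : s ∈ S),
      ∃ (B : Type u) (_ : CompleteBooleanAlgebra B) (_ : Nontrivial B)
        (M : BValStructure (L.withConsts C) B),
        M.IsModel ∧ M.Mixing ∧
        ∀ v : κ.out → M.carrier, M.val v (bigAnd hκ s (hfin s hs)) = ⊤ := by
  have : Nonempty (L.withConsts C).Const := ⟨Sum.inr (Classical.arbitrary C)⟩
  refine ⟨fun code => ⟨exists_isBigEnough S code, fun μ _ hμ =>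
    ⟨termModel_isModel, termModel_mixing, fun s hs v => val_eq_satVal _ v⟩⟩, fun s hs => ?_⟩
  -- Forcing with `T` gives the formulas of `s` value `⊤` outright.
  let T := {t ∈ S | s ⊆ t}
  have hT : IsConsistencyProperty L C κ T := hS.extensions s
  obtain ⟨code⟩ := nonempty_embedding_zfSet (L.withConsts C).Const
  obtain ⟨μ, -, hμ⟩ := exists_isBigEnough T code
  -- The set `s` is itself a condition, so the algebra is not degenerate.
  have : Nonempty (Cond T) := ⟨⟨s, s, ⟨hs, subset_rfl⟩, subset_rfl⟩⟩
  refine ⟨RO (Cond T), inferInstance, RO.nontrivial, termModel T code μ hμ, termModel_isModel,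
    termModel_mixing, fun v => ?_⟩
  rw [val_eq_satVal, bigAnd, satVal]
  refine iInf_eq_top.2 fun i => eq_top_iff.2 ?_
  refine (sigmaVal_eq_top fun t ht => ?_).ge.trans (hT.sigmaVal_le_satVal hκ code _ _)
  exact ht.2 (Subtype.prop _)
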